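/- Let $n\ge 3$, $r>0$, and let $\Sigma\subset\mathbb{R}^n$ be a Euclidean sphere of radius $r$ with two fixed diametrically opposite points $N,S\in\Sigma$ (the poles). A meridian of $\Sigma$ is the intersection of $\Sigma$ with an affine hyperplane of $\mathbb{R}^n$ that contains $N$ and $S$; it is an $(n-2)$-dimensional sphere. Let $K\subset\mathbb{R}^n$ be a bounded set such that for every meridian $C$ of $\Sigma$ there is a vector $v\in\mathbb{R}^n$ (which may depend on $C$) with $v+C\subset K$. Then the Hausdorff dimension of $K$ satisfies $\dim_H K\ge n-1$. The bound is sharp: $\Sigma$ itself is a bounded set that contains a translated copy of each of its meridians, and $\dim_H\Sigma=n-1$. -/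

import Mathlib

open Metric Bornology
open scoped ENNReal

/-- `C` is a meridian through the points `N` and `S` of the sphere with centre `c` and radius `r`
in `ℝⁿ`: the intersection of that sphere with an affine hyperplane containing `N` and `S`. -/
def IsMeridian {n : ℕ} (c : EuclideanSpace ℝ (Fin n)) (r : ℝ) (N S : EuclideanSpace ℝ (Fin n))
    (C : Set (EuclideanSpace ℝ (Fin n))) : Prop :=
  ∃ H : AffineSubspace ℝ (EuclideanSpace ℝ (Fin n)),
    Module.finrank ℝ H.direction + 1 = n ∧ N ∈ H ∧ S ∈ H ∧
      C = (H : Set (EuclideanSpace ℝ (Fin n))) ∩ sphere c r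

/-- `K` contains a translated copy of every meridian through `N` and `S` of the sphere with
centre `c` and radius `r`; the translation vector may depend on the meridian. -/
def ContainsMeridianTranslates {n : ℕ} (c : EuclideanSpace ℝ (Fin n)) (r : ℝ)
    (N S : EuclideanSpace ℝ (Fin n)) (K : Set (EuclideanSpace ℝ (Fin n))) : Prop :=
  ∀ C : Set (EuclideanSpace ℝ (Fin n)), IsMeridian c r N S C →
    ∃ v : EuclideanSpace ℝ (Fin n), (fun x => v + x) '' C ⊆ K

open MeasureTheory Set Filter Topology
open scoped InnerProductSpace

/-! Project along the axis `NS` to `ℝⁿ⁻¹`; this does not raise dimension. The hyperplane of a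
meridian contains the axis, so the meridian projects onto a solid `(n-2)`-ball of radius `r`. The
normals `B 1 - a • B 2`, `a ∈ [0, 1)`, suffice: the image of `K` contains, for each slope `a`, a
piece of the graph of `y ↦ a * y 0 + b` over a cube of fixed size. This is a planar Kakeya problem
with `n - 3` inert coordinates.

Córdoba's `L²` method settles it (`le_dimH_of_forall_slope`). If the image were `μH[s]`-null with `s
< n - 1`, cover it by small dyadic balls. Pigeonholing over points and then over slopes gives one
scale `2 ^ (-k)` whose balls catch a fraction `≳ k⁻²` of the graph for a set of slopes of measure `≳
k⁻²`. Plates with separated slopes overlap little, so these balls, doubled, have volume `≳ k⁻⁹`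
(`sq_le_volume_of_many_plates`); the cover bounds it by a constant times `2 ^ (-(n - 1 - s) k)`,
which is smaller for large `k`. -/

/-! ### Pigeonholing and dyadic covers -/

/-- Polynomial pigeonholing: a set covered by countably many pieces meets one of the pieces in at
least a `c / (k + 1) ^ 2` fraction of its measure. -/
theorem exists_measure_ge_of_subset_iUnion :
    ∃ c : ℝ, 0 < c ∧ ∀ {α : Type} [MeasurableSpace α] (μ : Measure α) (S : Set α) (A : ℕ → Set α),
      S ⊆ ⋃ k, A k → μ S ≠ 0 → μ S ≠ ∞ →
        ∃ k : ℕ, ENNReal.ofReal (c / ((k : ℝ) + 1) ^ 2) * μ S ≤ μ (A k) := by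
  have hs : Summable fun k : ℕ => 1 / ((k : ℝ) + 1) ^ 2 := by
    have := (summable_nat_add_iff 1).2 (Real.summable_one_div_nat_pow.2 (one_lt_two))
    simpa using this
  set Z := ∑' k : ℕ, 1 / ((k : ℝ) + 1) ^ 2 with hZ
  have hZ0 : 0 ≤ Z := tsum_nonneg fun k => by positivity
  refine ⟨1 / (Z + 1), by positivity, fun {α} _ μ S A hSA h0 htop => ?_⟩
  by_contra! hcon
  -- Only countable subadditivity is used, so the pieces need not be measurable.
  have hle : μ S ≤ ∑' k : ℕ, ENNReal.ofReal (1 / (Z + 1) / ((k : ℝ) + 1) ^ 2) * μ S :=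
    (measure_mono hSA).trans ((measure_iUnion_le A).trans
      (ENNReal.tsum_le_tsum fun k => (hcon k).le))
  have heq : ∀ k : ℕ, 1 / (Z + 1) / ((k : ℝ) + 1) ^ 2 = 1 / (Z + 1) * (1 / ((k : ℝ) + 1) ^ 2) :=
    fun k => by ring
  have hlt : ENNReal.ofReal (1 / (Z + 1) * Z) < 1 := by
    rw [← ENNReal.ofReal_one]
    refine (ENNReal.ofReal_lt_ofReal_iff one_pos).2 ?_
    rw [one_div, inv_mul_lt_iff₀ (by positivity)]
    linarith
  rw [ENNReal.tsum_mul_right, tsum_congr fun k => congrArg ENNReal.ofReal (heq k),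
    ← ENNReal.ofReal_tsum_of_nonneg (fun k => by positivity) (hs.mul_left _), tsum_mul_left,
    ← hZ] at hle
  have := ENNReal.mul_lt_mul_left h0 htop hlt
  rw [one_mul] at this
  exact absurd hle (not_le.2 this)

/-- A set of zero `s`-dimensional Hausdorff measure is covered by balls of dyadic radii
`2 ^ (-κ i)`, all of them small, with `∑ 2 ^ (-s κ i) ≤ 1`. -/
theorem exists_dyadic_cover_of_hausdorffMeasure_eq_zero {X : Type*} [MetricSpace X] [Nonempty X]
    [MeasurableSpace X] [BorelSpace X] {s : ℝ} (hs : 0 < s) {E : Set X} (hE : μH[s] E = 0)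
    (m : ℕ) :
    ∃ (x : ℕ → X) (κ : ℕ → ℕ), E ⊆ ⋃ i, closedBall (x i) ((1 / 2 : ℝ) ^ κ i) ∧
      (∀ i, m ≤ κ i) ∧ ∑' i, ENNReal.ofReal (((1 / 2 : ℝ) ^ κ i) ^ s) ≤ 1 := by
  -- The extra factor `1 / 2` pays for rounding radii up to powers of two.
  set σ : ℝ := ((1 / 2 : ℝ) ^ (m + 1)) ^ s with hσ
  have hσ0 : 0 < σ := by positivity
  have h2 : (ENNReal.ofReal σ / 2) ≠ 0 := by simp [hσ0]
  -- The summable perturbation `η` gives a positive radius even to pieces of diameter zero.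
  obtain ⟨η, hη, hηs⟩ := ENNReal.exists_pos_sum_of_countable' h2 ℕ
  have hcov : ∃ t : ℕ → Set X, E ⊆ ⋃ n, t n ∧
      ∑' n, ⨆ _ : (t n).Nonempty, ediam (t n) ^ s < ENNReal.ofReal σ / 2 := by
    rw [Measure.hausdorffMeasure_apply] at hE
    have h1 := ENNReal.iSup_eq_zero.1 hE 1
    have h1 := ENNReal.iSup_eq_zero.1 h1 one_pos
    have h3 := h1.trans_lt (pos_iff_ne_zero.2 h2)
    simp only [iInf_lt_iff] at h3
    obtain ⟨t, ht, -, h⟩ := h3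
    exact ⟨t, ht, h⟩
  obtain ⟨t, ht, hts⟩ := hcov
  set e : ℕ → ℝ≥0∞ := fun i => (⨆ _ : (t i).Nonempty, ediam (t i) ^ s) + η i with he
  have hesum : ∑' i, e i < ENNReal.ofReal σ := by
    rw [he, ENNReal.tsum_add, ← ENNReal.add_halves (ENNReal.ofReal σ)]
    exact ENNReal.add_lt_add hts hηs
  have hei : ∀ i, e i < ENNReal.ofReal σ := fun i => (ENNReal.le_tsum i).trans_lt hesum
  have hetop : ∀ i, e i ≠ ∞ := fun i => ((hei i).trans ENNReal.ofReal_lt_top).ne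
  have he0 : ∀ i, 0 < (e i).toReal := fun i =>
    ENNReal.toReal_pos ((hη i).trans_le le_add_self).ne' (hetop i)
  have heσ : ∀ i, (e i).toReal < σ := fun i => (ENNReal.lt_ofReal_iff_toReal_lt (hetop i)).1 (hei i)
  set ρ : ℕ → ℝ := fun i => (e i).toReal ^ (1 / s) with hρ
  have hρ0 : ∀ i, 0 < ρ i := fun i => Real.rpow_pos_of_pos (he0 i) _
  have hρs : ∀ i, ρ i ^ s = (e i).toReal := fun i => by
    rw [hρ, ← Real.rpow_mul (he0 i).le, one_div_mul_cancel hs.ne', Real.rpow_one]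
  have hρm : ∀ i, ρ i < (1 / 2 : ℝ) ^ (m + 1) := fun i => by
    rw [← Real.rpow_lt_rpow_iff (hρ0 i).le (by positivity) hs, hρs]
    exact heσ i
  have hκ : ∀ i, ∃ k : ℕ, (1 / 2 : ℝ) ^ (k + 1) < ρ i ∧ ρ i ≤ (1 / 2 : ℝ) ^ k := fun i =>
    exists_nat_pow_near_of_lt_one (hρ0 i)
      ((hρm i).le.trans (pow_le_one₀ (by norm_num) (by norm_num))) (by norm_num) (by norm_num)
  choose κ hκ1 hκ2 using hκ
  have hx : ∀ i, ∃ x : X, t i ⊆ closedBall x ((1 / 2 : ℝ) ^ κ i) := by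
    intro i
    rcases (t i).eq_empty_or_nonempty with h | ⟨x, hx⟩
    · exact ⟨Classical.arbitrary X, by simp [h]⟩
    refine ⟨x, fun y hy => ?_⟩
    rw [mem_closedBall]
    refine le_trans ?_ (hκ2 i)
    have h1 : ediam (t i) ^ s ≤ e i := by
      refine le_trans ?_ le_self_add
      exact le_iSup_of_le (⟨x, hx⟩ : (t i).Nonempty) le_rfl
    have h2 : edist y x ^ s ≤ e i :=
      (ENNReal.rpow_le_rpow (edist_le_ediam_of_mem hy hx) hs.le).trans h1
    have h3 := ENNReal.toReal_mono (hetop i) h2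
    rw [← ENNReal.toReal_rpow, ← hρs, ← dist_edist] at h3
    exact (Real.rpow_le_rpow_iff dist_nonneg (hρ0 i).le hs).1 h3
  choose x hx using hx
  refine ⟨x, κ, ht.trans (iUnion_mono hx), fun i => ?_, ?_⟩
  · have := (hκ1 i).trans (hρm i)
    have := (pow_lt_pow_iff_right_of_lt_one₀ (by norm_num) (by norm_num)).1 this
    omega
  · have hb : ∀ i, ENNReal.ofReal (((1 / 2 : ℝ) ^ κ i) ^ s) ≤ ENNReal.ofReal (2 ^ s) * e i := by
      intro i
      rw [← ENNReal.ofReal_toReal (hetop i), ← ENNReal.ofReal_mul (by positivity), ← hρs,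
        ← Real.mul_rpow (by norm_num) (hρ0 i).le]
      refine ENNReal.ofReal_le_ofReal (Real.rpow_le_rpow (by positivity) ?_ hs.le)
      have := hκ1 i
      rw [pow_succ] at this
      linarith
    refine (ENNReal.tsum_le_tsum hb).trans ?_
    rw [ENNReal.tsum_mul_left]
    refine (mul_le_mul_right hesum.le _).trans ?_
    rw [← ENNReal.ofReal_mul (by positivity), hσ, ← Real.mul_rpow (by norm_num) (by positivity)]
    refine ENNReal.ofReal_le_one.2 (Real.rpow_le_one (by positivity) ?_ hs.le)
    rw [pow_succ]
    have : (1 / 2 : ℝ) ^ m ≤ 1 := pow_le_one₀ (by norm_num) (by norm_num)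
    linarith

/-! ### Two inequalities behind the `L²` estimate -/

/-- Cauchy–Schwarz for the indicator of `F` and the counting function `∑ 1_{T j}`. -/
theorem sq_sum_measure_inter_le {α ι : Type*} [MeasurableSpace α] (μ : Measure α) (J : Finset ι)
    (T : ι → Set α) (hT : ∀ j ∈ J, MeasurableSet (T j)) {F : Set α} (hF : MeasurableSet F) :
    (∑ j ∈ J, μ (T j ∩ F)) ^ 2 ≤ μ F * ∑ i ∈ J, ∑ j ∈ J, μ (T i ∩ T j) := by
  set f : α → ℝ≥0∞ := F.indicator 1 with hf
  set g : α → ℝ≥0∞ := fun x => ∑ j ∈ J, (T j).indicator 1 x with hg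
  have hfm : Measurable f := measurable_one.indicator hF
  have hgm : Measurable g :=
    Finset.measurable_fun_sum J fun j hj => measurable_one.indicator (hT j hj)
  have h1 : ∫⁻ x, (f * g) x ∂μ = ∑ j ∈ J, μ (T j ∩ F) := by
    have : ∀ x, (f * g) x = ∑ j ∈ J, (T j ∩ F).indicator 1 x := fun x => by
      simp only [hf, hg, Pi.mul_apply, Finset.mul_sum]
      refine Finset.sum_congr rfl fun j _ => ?_
      rw [inter_comm, inter_indicator_one]; rfl
    simp_rw [this]
    rw [lintegral_finsetSum' _ fun j hj =>
      (measurable_one.indicator ((hT j hj).inter hF)).aemeasurable]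
    exact Finset.sum_congr rfl fun j hj => lintegral_indicator_one ((hT j hj).inter hF)
  have h2 : ∫⁻ x, f x ^ (2 : ℝ) ∂μ = μ F := by
    rw [← lintegral_indicator_one hF]
    refine lintegral_congr fun x => ?_
    by_cases hx : x ∈ F <;> simp [hf, hx]
  have h3 : ∫⁻ x, g x ^ (2 : ℝ) ∂μ = ∑ i ∈ J, ∑ j ∈ J, μ (T i ∩ T j) := by
    have : ∀ x, g x ^ (2 : ℝ) = ∑ i ∈ J, ∑ j ∈ J, (T i ∩ T j).indicator 1 x := fun x => by
      rw [ENNReal.rpow_two, sq, hg, Finset.sum_mul_sum]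
      refine Finset.sum_congr rfl fun i _ => Finset.sum_congr rfl fun j _ => ?_
      rw [inter_indicator_one]; rfl
    simp_rw [this]
    rw [lintegral_finsetSum' _ fun i hi => (Finset.measurable_fun_sum J fun j hj =>
      measurable_one.indicator ((hT i hi).inter (hT j hj))).aemeasurable]
    refine Finset.sum_congr rfl fun i hi => ?_
    rw [lintegral_finsetSum' _ fun j hj =>
      (measurable_one.indicator ((hT i hi).inter (hT j hj))).aemeasurable]
    exact Finset.sum_congr rfl fun j hj => lintegral_indicator_one ((hT i hi).inter (hT j hj))
  have key := ENNReal.lintegral_mul_le_Lp_mul_Lq μ Real.HolderConjugate.two_two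
    hfm.aemeasurable hgm.aemeasurable
  rw [h1, h2, h3] at key
  have h4 := pow_le_pow_left' key 2
  rw [mul_pow] at h4
  simpa only [← ENNReal.rpow_natCast, ← ENNReal.rpow_mul, Nat.cast_ofNat, one_div,
    inv_mul_cancel₀ (two_ne_zero' ℝ), ENNReal.rpow_one] using h4

/-- In each row, the terms with `j < i` and those with `j ≥ i` are each dominated by a partial
harmonic sum. -/
theorem sum_sum_inv_abs_sub_le (M : ℕ) :
    ∑ i ∈ Finset.range M, ∑ j ∈ Finset.range M, 1 / (|(i : ℝ) - j| + 1) ≤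
      2 * M * (1 + Real.log M) := by
  have hH : ∀ i ∈ Finset.range M, ∑ j ∈ Finset.range M, 1 / (|(i : ℝ) - j| + 1) ≤
      2 * (1 + Real.log M) := by
    intro i hi
    have hi := Finset.mem_range.1 hi
    have hb : ∀ N ≤ M, ∑ d ∈ Finset.range N, 1 / ((d : ℝ) + 1) ≤ 1 + Real.log M := by
      intro N hN
      have h := harmonic_le_one_add_log M
      rw [harmonic] at h
      push_cast at h
      refine le_trans ?_ h
      simp only [one_div]
      exact Finset.sum_le_sum_of_subset_of_nonneg (Finset.range_mono hN)
        fun d _ _ => by positivity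
    rw [← Finset.sum_range_add_sum_Ico _ hi.le, two_mul]
    refine add_le_add ?_ ?_
    · rw [← Finset.sum_range_reflect]
      refine le_trans (Finset.sum_le_sum fun j hj => ?_) (hb i hi.le)
      have hj := Finset.mem_range.1 hj
      refine one_div_le_one_div_of_le (by positivity) ?_
      have : ((i - 1 - j : ℕ) : ℝ) = i - 1 - j := by
        rw [Nat.cast_sub (by omega), Nat.cast_sub (by omega)]; simp
      rw [this]
      have := le_abs_self ((i : ℝ) - (i - 1 - j))
      linarith
    · rw [Finset.sum_Ico_eq_sum_range]
      refine le_trans (Finset.sum_le_sum fun j hj => ?_) (hb (M - i) (Nat.sub_le _ _))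
      refine one_div_le_one_div_of_le (by positivity) ?_
      push_cast
      have := neg_abs_le ((i : ℝ) - (i + j))
      linarith
  refine (Finset.sum_le_sum hH).trans ?_
  rw [Finset.sum_const, Finset.card_range, nsmul_eq_mul]
  linarith

/-! ### Plates and their intersections -/

/-- The `δ`-neighbourhood, in the last coordinate, of the graph of `y ↦ a * y 0 + b` over the cube
with centre `w` and side `2 * ρ`. -/
def plate {q : ℕ} (ρ δ a b : ℝ) (w : Fin (q + 1) → ℝ) : Set ((Fin (q + 1) → ℝ) × ℝ) :=
  {z | z.1 ∈ closedBall w ρ ∧ |z.2 - (a * z.1 0 + b)| ≤ δ}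

theorem isClosed_plate {q : ℕ} (ρ δ a b : ℝ) (w : Fin (q + 1) → ℝ) :
    IsClosed (plate ρ δ a b w) :=
  ((isClosed_closedBall (x := w) (ε := ρ)).preimage continuous_fst).inter
    (isClosed_le (f := fun z : (Fin (q + 1) → ℝ) × ℝ => |z.2 - (a * z.1 0 + b)|) (by fun_prop)
      continuous_const)

theorem volume_abs_sub_le (t δ : ℝ) : volume {x : ℝ | |x - t| ≤ δ} = ENNReal.ofReal (2 * δ) := by
  have : {x : ℝ | |x - t| ≤ δ} = closedBall t δ := by
    ext x; simp [Real.dist_eq]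
  rw [this, Real.volume_closedBall]

theorem volume_strip_le {q : ℕ} {ρ δ α β : ℝ} (hρ : 0 ≤ ρ) (hα : α ≠ 0)
    (w : Fin (q + 1) → ℝ) :
    volume {y | y ∈ closedBall w ρ ∧ |α * y 0 + β| ≤ 2 * δ} ≤
      ENNReal.ofReal (4 * δ / |α|) * ENNReal.ofReal ((2 * ρ) ^ q) := by
  set s : Fin (q + 1) → Set ℝ :=
    Fin.cons {x : ℝ | |x - -β / α| ≤ 2 * δ / |α|} fun i => closedBall (w i.succ) ρ with hs
  have hsub : {y | y ∈ closedBall w ρ ∧ |α * y 0 + β| ≤ 2 * δ} ⊆ Set.pi univ s := by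
    rintro y ⟨hy, hy0⟩ i -
    refine Fin.cases ?_ (fun i => ?_) i
    · simp only [hs, Fin.cons_zero, mem_ofPred_eq]
      rw [le_div_iff₀ (abs_pos.2 hα), ← abs_mul]
      have : (y 0 - -β / α) * α = α * y 0 + β := by field_simp; ring
      rwa [this]
    · simp only [hs, Fin.cons_succ]
      rw [mem_closedBall] at hy ⊢
      exact (dist_le_pi_dist y w i.succ).trans hy
  refine (measure_mono hsub).trans ?_
  rw [volume_pi_pi, Fin.prod_univ_succ]
  simp only [hs, Fin.cons_zero, Fin.cons_succ, volume_abs_sub_le, Real.volume_closedBall,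
    Finset.prod_const, Finset.card_univ, Fintype.card_fin]
  rw [ENNReal.ofReal_pow (by positivity)]
  refine le_of_eq ?_
  congr 2
  ring

/-- Fubini: a vertical fibre has length at most `2 * δ`, and is empty unless the two graphs are
within `2 * δ` there. -/
theorem volume_plate_inter_le {q : ℕ} {ρ δ a b a' b' : ℝ}
    (w w' : Fin (q + 1) → ℝ) :
    volume (plate ρ δ a b w ∩ plate ρ δ a' b' w') ≤ ENNReal.ofReal (2 * δ) *
      volume {y | y ∈ closedBall w ρ ∧ |(a - a') * y 0 + (b - b')| ≤ 2 * δ} := by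
  have hmeas : MeasurableSet {y : Fin (q + 1) → ℝ |
      y ∈ closedBall w ρ ∧ |(a - a') * y 0 + (b - b')| ≤ 2 * δ} :=
    ((isClosed_closedBall (x := w) (ε := ρ)).inter
      (isClosed_le (f := fun y : Fin (q + 1) → ℝ => |(a - a') * y 0 + (b - b')|) (by fun_prop)
        continuous_const)).measurableSet
  rw [Measure.volume_eq_prod, Measure.prod_apply
    ((isClosed_plate ..).inter (isClosed_plate ..)).measurableSet,
    ← lintegral_indicator_const hmeas]
  refine lintegral_mono fun y => ?_
  by_cases hy : y ∈ {y : Fin (q + 1) → ℝ |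
      y ∈ closedBall w ρ ∧ |(a - a') * y 0 + (b - b')| ≤ 2 * δ}
  · rw [indicator_of_mem hy, ← volume_abs_sub_le (a * y 0 + b) δ]
    exact measure_mono fun x hx => hx.1.2
  · rw [indicator_of_notMem hy, nonpos_iff_eq_zero]
    refine (congrArg volume (eq_empty_of_forall_notMem fun x hx => hy ⟨hx.1.1, ?_⟩)).trans
      measure_empty
    have h1 := abs_le.1 hx.1.2
    have h2 := abs_le.1 hx.2.2
    simp only at h1 h2
    rw [abs_le]
    constructor <;> linarith

/-- Here `d` will be the index distance of two slope cells of width `δ`. For `d < 2` the whole cube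
is a good enough bound, as `d + 1 < 3`; for `d ≥ 2` the strip bound applies with `d - 1 ≥ (d + 1) /
3`. -/
theorem volume_plate_inter_le_of_separated {q : ℕ} {ρ δ d a b a' b' : ℝ} (hρ : 0 ≤ ρ) (hδ : 0 < δ)
    (hd0 : 0 ≤ d) (hd : (d - 1) * δ ≤ |a - a'|) (w w' : Fin (q + 1) → ℝ) :
    volume (plate ρ δ a b w ∩ plate ρ δ a' b' w') ≤
      ENNReal.ofReal ((6 * (2 * ρ) ^ (q + 1) + 24 * (2 * ρ) ^ q) * δ * (1 / (d + 1))) := by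
  refine (volume_plate_inter_le w w').trans ?_
  have hA : 0 ≤ (2 * ρ) ^ q := by positivity
  have hB : 0 ≤ (2 * ρ) ^ (q + 1) := by positivity
  rcases lt_or_ge d 2 with h | h
  · have h1 : volume {y | y ∈ closedBall w ρ ∧ |(a - a') * y 0 + (b - b')| ≤ 2 * δ} ≤
        ENNReal.ofReal ((2 * ρ) ^ (q + 1)) := by
      refine (measure_mono fun y hy => hy.1).trans_eq ?_
      · rw [Real.volume_pi_closedBall _ hρ, Fintype.card_fin]
    refine (mul_le_mul_right h1 _).trans ?_
    rw [← ENNReal.ofReal_mul (by positivity)]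
    refine ENNReal.ofReal_le_ofReal ?_
    rw [mul_one_div, le_div_iff₀ (by positivity)]
    have h2 : 2 * δ * (2 * ρ) ^ (q + 1) * (d + 1) ≤ 2 * δ * (2 * ρ) ^ (q + 1) * 3 :=
      mul_le_mul_of_nonneg_left (by linarith) (by positivity)
    have h3 : 0 ≤ 24 * (2 * ρ) ^ q * δ := by positivity
    linarith
  · have hpos : 0 < |a - a'| := lt_of_lt_of_le (by nlinarith) hd
    refine (mul_le_mul_right (volume_strip_le hρ (abs_pos.1 hpos) w) _).trans ?_
    rw [← ENNReal.ofReal_mul (by positivity), ← ENNReal.ofReal_mul (by positivity)]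
    refine ENNReal.ofReal_le_ofReal ?_
    have h1 : 4 * δ / |a - a'| ≤ 12 * (1 / (d + 1)) := by
      rw [mul_one_div, div_le_div_iff₀ hpos (by positivity)]
      nlinarith
    have h2 : 2 * δ * (4 * δ / |a - a'| * (2 * ρ) ^ q) ≤
        2 * δ * (12 * (1 / (d + 1)) * (2 * ρ) ^ q) := by gcongr
    refine h2.trans ?_
    have h3 : 0 ≤ 6 * (2 * ρ) ^ (q + 1) * δ * (1 / (d + 1)) := by positivity
    linarith

theorem le_volume_plate_inter {q : ℕ} {ρ δ a b : ℝ} (w : Fin (q + 1) → ℝ)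
    {P F : Set ((Fin (q + 1) → ℝ) × ℝ)} (hP : MeasurableSet P) (hF : MeasurableSet F)
    (hPF : ∀ y t t', (y, t) ∈ P → |t' - t| ≤ δ → (y, t') ∈ F) :
    ENNReal.ofReal (2 * δ) * volume {y | y ∈ closedBall w ρ ∧ (y, a * y 0 + b) ∈ P} ≤
      volume (plate ρ δ a b w ∩ F) := by
  have hmeas : MeasurableSet {y : Fin (q + 1) → ℝ | y ∈ closedBall w ρ ∧ (y, a * y 0 + b) ∈ P} :=
    isClosed_closedBall.measurableSet.inter
      ((show Measurable fun y : Fin (q + 1) → ℝ => (y, a * y 0 + b) by fun_prop) hP)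
  rw [Measure.volume_eq_prod, Measure.prod_apply ((isClosed_plate ..).measurableSet.inter hF),
    ← lintegral_indicator_const hmeas]
  refine lintegral_mono fun y => ?_
  by_cases hy : y ∈ {y : Fin (q + 1) → ℝ | y ∈ closedBall w ρ ∧ (y, a * y 0 + b) ∈ P}
  · rw [indicator_of_mem hy, ← volume_abs_sub_le (a * y 0 + b) δ]
    exact measure_mono fun x hx => ⟨⟨hy.1, hx⟩, hPF _ _ _ hy.2 hx⟩
  · rw [indicator_of_notMem hy]
    exact zero_le

/-- Córdoba's `L²` estimate at the scale `2 ^ (-k)`. -/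
theorem sq_le_volume_of_many_plates {q : ℕ} {ρ η ζ : ℝ} (hρ : 0 ≤ ρ) (hζ : 0 ≤ ζ)
    (k : ℕ) (b : ℝ → ℝ) (w : ℝ → Fin (q + 1) → ℝ)
    {P F : Set ((Fin (q + 1) → ℝ) × ℝ)} (hP : MeasurableSet P) (hF : MeasurableSet F)
    (hPF : ∀ y t t', (y, t) ∈ P → |t' - t| ≤ (1 / 2 : ℝ) ^ k → (y, t') ∈ F)
    {Θ : Set ℝ} (hΘ : Θ ⊆ Ico 0 1) (hΘη : ENNReal.ofReal η ≤ volume Θ)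
    (hζΘ : ∀ a ∈ Θ, ENNReal.ofReal ζ ≤
      volume {y | y ∈ closedBall (w a) ρ ∧ (y, a * y 0 + b a) ∈ P}) :
    ENNReal.ofReal (2 * η * ζ) ^ 2 ≤ volume F *
      ENNReal.ofReal ((6 * (2 * ρ) ^ (q + 1) + 24 * (2 * ρ) ^ q) * 2 * (k + 1)) := by
  classical
  set δ : ℝ := (1 / 2 : ℝ) ^ k with hδ
  have hδ0 : 0 < δ := by positivity
  have hδ2 : δ * 2 ^ k = 1 := by rw [hδ, ← mul_pow]; norm_num
  set C : ℝ := 6 * (2 * ρ) ^ (q + 1) + 24 * (2 * ρ) ^ q with hC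
  have hC0 : 0 ≤ C := by positivity
  -- One slope is kept from each `δ`-cell meeting `Θ`; there are at least `η / δ` such cells.
  set J : Finset ℕ := (Finset.range (2 ^ k)).filter
    fun j => (Θ ∩ Ico (j * δ) ((j + 1) * δ)).Nonempty with hJ
  have hcover : Θ ⊆ ⋃ j ∈ J, Ico (j * δ) ((j + 1) * δ) := by
    intro a ha
    have ha01 := hΘ ha
    have hpos : 0 ≤ a * 2 ^ k := mul_nonneg ha01.1 (by positivity)
    have h1 : a = (a * 2 ^ k) * δ := by rw [mul_assoc, mul_comm _ δ, hδ2, mul_one]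
    have hmem : a ∈ Ico ((⌊a * 2 ^ k⌋₊ : ℝ) * δ) (((⌊a * 2 ^ k⌋₊ : ℝ) + 1) * δ) := by
      constructor
      · conv_rhs => rw [h1]
        exact mul_le_mul_of_nonneg_right (Nat.floor_le hpos) hδ0.le
      · conv_lhs => rw [h1]
        exact mul_lt_mul_of_pos_right (Nat.lt_floor_add_one _) hδ0
    refine mem_iUnion₂.2 ⟨⌊a * 2 ^ k⌋₊, ?_, hmem⟩
    rw [hJ, Finset.mem_filter, Finset.mem_range]
    refine ⟨(Nat.floor_lt hpos).2 ?_, a, ha, hmem⟩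
    push_cast
    exact mul_lt_of_lt_one_left (by positivity) ha01.2
  have hcard : η ≤ J.card * δ := by
    have h1 : volume Θ ≤ ∑ j ∈ J, ENNReal.ofReal δ := by
      refine (measure_mono hcover).trans ((measure_biUnion_finset_le _ _).trans_eq ?_)
      refine Finset.sum_congr rfl fun j _ => ?_
      rw [Real.volume_Ico]
      congr 1
      ring
    rw [Finset.sum_const, nsmul_eq_mul, ← ENNReal.ofReal_natCast,
      ← ENNReal.ofReal_mul (by positivity)] at h1
    exact (ENNReal.ofReal_le_ofReal_iff (by positivity)).1 (hΘη.trans h1)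
  have hsel : ∀ j : ℕ, ∃ a : ℝ, j ∈ J → a ∈ Θ ∧ a ∈ Ico (j * δ) ((j + 1) * δ) := by
    intro j
    by_cases hj : j ∈ J
    · obtain ⟨a, ha⟩ := (Finset.mem_filter.1 hj).2
      exact ⟨a, fun _ => ha⟩
    · exact ⟨0, fun h => absurd h hj⟩
  choose a ha using hsel
  set T : ℕ → Set ((Fin (q + 1) → ℝ) × ℝ) := fun j => plate ρ δ (a j) (b (a j)) (w (a j)) with hT
  have hCS := sq_sum_measure_inter_le volume J T
    (fun j _ => (isClosed_plate ..).measurableSet) hF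
  have hlow : ENNReal.ofReal (2 * η * ζ) ≤ ∑ j ∈ J, volume (T j ∩ F) := by
    have h1 : ∀ j ∈ J, ENNReal.ofReal (2 * δ * ζ) ≤ volume (T j ∩ F) := fun j hj => by
      rw [ENNReal.ofReal_mul (by positivity)]
      exact (mul_le_mul_right (hζΘ _ (ha j hj).1) _).trans (le_volume_plate_inter _ hP hF hPF)
    refine le_trans ?_ (Finset.sum_le_sum h1)
    rw [Finset.sum_const, nsmul_eq_mul, ← ENNReal.ofReal_natCast,
      ← ENNReal.ofReal_mul (by positivity)]
    refine ENNReal.ofReal_le_ofReal ?_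
    nlinarith [mul_le_mul_of_nonneg_right hcard hζ]
  have hup : ∑ i ∈ J, ∑ j ∈ J, volume (T i ∩ T j) ≤ ENNReal.ofReal (C * 2 * (k + 1)) := by
    have h1 : ∀ i ∈ J, ∀ j ∈ J, volume (T i ∩ T j) ≤
        ENNReal.ofReal (C * δ * (1 / (|(i : ℝ) - j| + 1))) := fun i hi j hj => by
      refine volume_plate_inter_le_of_separated hρ hδ0 (abs_nonneg _) ?_ _ _
      have hai := (ha i hi).2
      have haj := (ha j hj).2
      rw [mem_Ico] at hai haj
      rw [sub_mul, one_mul, sub_le_iff_le_add, ← abs_of_pos hδ0, ← abs_mul, abs_of_pos hδ0]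
      have h3 := le_abs_self (a i - a j)
      have h4 := neg_abs_le (a i - a j)
      rw [abs_le]
      constructor <;> linarith
    have h2 : ∑ i ∈ J, ∑ j ∈ J, volume (T i ∩ T j) ≤
        ∑ i ∈ Finset.range (2 ^ k), ∑ j ∈ Finset.range (2 ^ k),
          ENNReal.ofReal (C * δ * (1 / (|(i : ℝ) - j| + 1))) := by
      refine (Finset.sum_le_sum fun i hi => Finset.sum_le_sum fun j hj => h1 i hi j hj).trans ?_
      refine (Finset.sum_le_sum_of_subset (Finset.filter_subset _ _)).trans ?_
      exact Finset.sum_le_sum fun i _ => Finset.sum_le_sum_of_subset (Finset.filter_subset _ _)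
    refine h2.trans ?_
    rw [Finset.sum_congr rfl fun (i : ℕ) _ =>
      (ENNReal.ofReal_sum_of_nonneg (f := fun j : ℕ => C * δ * (1 / (|(i : ℝ) - j| + 1)))
        fun j _ => by positivity).symm, ← ENNReal.ofReal_sum_of_nonneg fun i _ => Finset.sum_nonneg fun j _ => by positivity]
    refine ENNReal.ofReal_le_ofReal ?_
    simp_rw [← Finset.mul_sum]
    refine (mul_le_mul_of_nonneg_left (sum_sum_inv_abs_sub_le (2 ^ k)) (by positivity)).trans ?_
    push_cast
    rw [Real.log_pow]
    have hlog : Real.log 2 ≤ 1 := by linarith [Real.log_two_lt_d9]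
    have h5 : C * δ * (2 * 2 ^ k * (1 + k * Real.log 2)) = C * 2 * (1 + k * Real.log 2) := by
      linear_combination (C * 2 * (1 + k * Real.log 2)) * hδ2
    rw [h5]
    refine mul_le_mul_of_nonneg_left ?_ (by positivity)
    nlinarith [Nat.cast_nonneg (α := ℝ) k]
  exact (pow_le_pow_left' hlow 2).trans (hCS.trans (mul_le_mul_right hup _))

/-! ### Full dimension from a graph of every slope -/

theorem volume_closedBall_pi_prod {q : ℕ} (z : (Fin (q + 1) → ℝ) × ℝ) {r : ℝ} (hr : 0 ≤ r) :
    volume (closedBall z r) = ENNReal.ofReal ((2 * r) ^ (q + 2)) := by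
  obtain ⟨y, t⟩ := z
  rw [← closedBall_prod_same, Measure.volume_eq_prod, Measure.prod_prod,
    Real.volume_pi_closedBall _ hr, Real.volume_closedBall, ← ENNReal.ofReal_mul (by positivity),
    Fintype.card_fin, ← pow_succ]

theorem eventually_pow_mul_geometric_lt {θ A B : ℝ} (hθ0 : 0 < θ) (hθ : θ < 1) (hA : 0 < A)
    (p : ℕ) : ∃ m : ℕ, ∀ k ≥ m, B * (((k : ℝ) + 1) ^ p * θ ^ k) < A := by
  have h1 := tendsto_pow_const_mul_const_pow_of_abs_lt_one p (r := θ) (by rwa [abs_of_pos hθ0])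
  have h2 := ((tendsto_add_atTop_iff_nat 1).2 h1).const_mul (B * θ⁻¹)
  rw [mul_zero] at h2
  obtain ⟨m, hm⟩ := eventually_atTop.1 (h2.eventually_lt_const hA)
  refine ⟨m, fun k hk => ?_⟩
  have h3 := hm k hk
  push_cast at h3
  rw [pow_succ] at h3
  calc _ = B * θ⁻¹ * (((k : ℝ) + 1) ^ p * (θ ^ k * θ)) := by field_simp
    _ < A := h3

/-- A set containing, for every slope `a ∈ [0, 1)`, a translate of the graph of `y ↦ a * y 0` over
a cube of fixed size has full Hausdorff dimension. -/
theorem le_dimH_of_forall_slope {q : ℕ} {ρ : ℝ} (hρ : 0 < ρ) {E : Set ((Fin (q + 1) → ℝ) × ℝ)}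
    (hE : ∀ a ∈ Ico (0 : ℝ) 1, ∃ (b : ℝ) (w : Fin (q + 1) → ℝ),
      ∀ y ∈ closedBall w ρ, (y, a * y 0 + b) ∈ E) :
    ((q + 2 : ℕ) : ℝ≥0∞) ≤ dimH E := by
  by_contra! hlt
  obtain ⟨s, hEs, hsq⟩ := ENNReal.lt_iff_exists_nnreal_btwn.1 hlt
  have hs : (0 : ℝ) < s := by
    have := (zero_le (a := dimH E)).trans_lt hEs
    exact_mod_cast this
  have hsq : (s : ℝ) < q + 2 := by
    have : s < (q + 2 : ℕ) := by exact_mod_cast hsq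
    exact_mod_cast this
  have hE0 : μH[(s : ℝ)] E = 0 := hausdorffMeasure_of_dimH_lt hEs
  have hE' : ∀ a : ℝ, ∃ (b : ℝ) (w : Fin (q + 1) → ℝ), a ∈ Ico (0 : ℝ) 1 →
      ∀ y ∈ closedBall w ρ, (y, a * y 0 + b) ∈ E := by
    intro a
    by_cases ha : a ∈ Ico (0 : ℝ) 1
    · obtain ⟨b, w, h⟩ := hE a ha
      exact ⟨b, w, fun _ => h⟩
    · exact ⟨0, 0, fun h => absurd h ha⟩
  choose b w hbw using hE'
  obtain ⟨c, hc, hpigeon⟩ := exists_measure_ge_of_subset_iUnion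
  set V : ℝ := (2 * ρ) ^ (q + 1) with hV
  have hV0 : 0 < V := by positivity
  have hvol : ∀ w : Fin (q + 1) → ℝ, volume (closedBall w ρ) = ENNReal.ofReal V := fun w => by
    rw [Real.volume_pi_closedBall _ hρ.le, Fintype.card_fin]
  set C : ℝ := 6 * (2 * ρ) ^ (q + 1) + 24 * (2 * ρ) ^ q with hC
  set θ : ℝ := (1 / 2 : ℝ) ^ ((q : ℝ) + 2 - s) with hθ
  have hθ0 : 0 < θ := by positivity
  have hθ1 : θ < 1 := Real.rpow_lt_one (by norm_num) (by norm_num) (by linarith)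
  -- Exponent `9 = 8 + 1`: `(η * ζ) ^ 2` costs `(k + 1) ^ 8`, the harmonic sum one more.
  obtain ⟨m, hm⟩ := eventually_pow_mul_geometric_lt (A := 4 * c ^ 4 * V ^ 2)
    (B := 4 ^ (q + 2) * (C * 2)) hθ0 hθ1 (by positivity) 9
  obtain ⟨x, κ, hcov, hκ, hsum⟩ := exists_dyadic_cover_of_hausdorffMeasure_eq_zero hs hE0 m
  set P : ℕ → Set ((Fin (q + 1) → ℝ) × ℝ) := fun k =>
    ⋃ i, ⋃ (_ : κ i = k), closedBall (x i) ((1 / 2 : ℝ) ^ k) with hP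
  have hPm : ∀ k, MeasurableSet (P k) := fun k =>
    MeasurableSet.iUnion fun i => MeasurableSet.iUnion fun _ => isClosed_closedBall.measurableSet
  set A : ℝ → ℕ → Set (Fin (q + 1) → ℝ) := fun a k =>
    {y | y ∈ closedBall (w a) ρ ∧ (y, a * y 0 + b a) ∈ P k} with hA
  set Θ : ℕ → Set ℝ := fun k => {a | a ∈ Ico (0 : ℝ) 1 ∧
    ENNReal.ofReal (c / ((k : ℝ) + 1) ^ 2 * V) ≤ volume (A a k)} with hΘ
  have hΘcov : Ico (0 : ℝ) 1 ⊆ ⋃ k, Θ k := by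
    intro a ha
    have h1 : closedBall (w a) ρ ⊆ ⋃ k, A a k := by
      intro y hy
      obtain ⟨i, hi⟩ := mem_iUnion.1 (hcov (hbw a ha y hy))
      exact mem_iUnion.2 ⟨κ i, hy, mem_iUnion₂.2 ⟨i, rfl, hi⟩⟩
    obtain ⟨k, hk⟩ := hpigeon volume (closedBall (w a) ρ) (A a) h1
      (by rw [hvol]; simpa using hV0) (by rw [hvol]; exact ENNReal.ofReal_ne_top)
    rw [hvol, ← ENNReal.ofReal_mul (by positivity)] at hk
    exact mem_iUnion.2 ⟨k, ha, hk⟩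
  obtain ⟨k, hk⟩ := hpigeon volume (Ico (0 : ℝ) 1) Θ hΘcov (by simp) (by simp)
  rw [Real.volume_Ico, sub_zero, ENNReal.ofReal_one, mul_one] at hk
  have hmk : m ≤ k := by
    have h1 : (Θ k).Nonempty := by
      refine nonempty_of_measure_ne_zero (μ := volume) (ne_of_gt (lt_of_lt_of_le ?_ hk))
      exact ENNReal.ofReal_pos.2 (by positivity)
    obtain ⟨a, -, ha⟩ := h1
    have h2 : (A a k).Nonempty := by
      refine nonempty_of_measure_ne_zero (μ := volume) (ne_of_gt (lt_of_lt_of_le ?_ ha))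
      exact ENNReal.ofReal_pos.2 (by positivity)
    obtain ⟨y, -, hy⟩ := h2
    obtain ⟨i, hi, -⟩ := mem_iUnion₂.1 hy
    exact hi ▸ hκ i
  -- Doubled radii leave room for the thickness of the plates.
  set F : Set ((Fin (q + 1) → ℝ) × ℝ) :=
    ⋃ i, ⋃ (_ : κ i = k), closedBall (x i) (2 * (1 / 2 : ℝ) ^ k) with hF
  have hFm : MeasurableSet F :=
    MeasurableSet.iUnion fun i => MeasurableSet.iUnion fun _ => isClosed_closedBall.measurableSet
  have hPF : ∀ y t t', (y, t) ∈ P k → |t' - t| ≤ (1 / 2 : ℝ) ^ k → (y, t') ∈ F := by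
    intro y t t' h ht
    obtain ⟨i, hi, hy⟩ := mem_iUnion₂.1 h
    refine mem_iUnion₂.2 ⟨i, hi, ?_⟩
    rw [mem_closedBall] at hy ⊢
    refine (dist_triangle _ (y, t) _).trans ?_
    rw [two_mul]
    refine add_le_add ?_ hy
    rw [Prod.dist_eq, dist_self, Real.dist_eq]
    exact max_le (by positivity) ht
  have hFvol : volume F ≤ ENNReal.ofReal (4 ^ (q + 2) * θ ^ k) := by
    have hθk : 4 ^ (q + 2) * θ ^ k * (((1 / 2 : ℝ) ^ k) ^ (s : ℝ)) =
        (2 * (2 * (1 / 2 : ℝ) ^ k)) ^ (q + 2) := by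
      have h1 : (0 : ℝ) < (1 / 2 : ℝ) ^ k := by positivity
      have h2 : θ ^ k = ((1 / 2 : ℝ) ^ k) ^ ((q : ℝ) + 2 - s) := by
        rw [hθ, ← Real.rpow_natCast, ← Real.rpow_mul (by norm_num), mul_comm,
          Real.rpow_mul (by norm_num), Real.rpow_natCast]
      rw [mul_assoc, h2, ← Real.rpow_add h1, sub_add_cancel]
      have h3 : ((q : ℝ) + 2) = ((q + 2 : ℕ) : ℝ) := by push_cast; ring
      rw [h3, Real.rpow_natCast, ← mul_pow]
      congr 1
      ring
    have h1 : ∀ i, volume (⋃ (_ : κ i = k), closedBall (x i) (2 * (1 / 2 : ℝ) ^ k)) ≤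
        ENNReal.ofReal (4 ^ (q + 2) * θ ^ k) * ENNReal.ofReal (((1 / 2 : ℝ) ^ κ i) ^ (s : ℝ)) := by
      intro i
      by_cases hi : κ i = k
      · simp only [hi, iUnion_true]
        rw [volume_closedBall_pi_prod _ (by positivity), ← ENNReal.ofReal_mul (by positivity), hθk]
      · simp [hi]
    refine (measure_iUnion_le _).trans ((ENNReal.tsum_le_tsum h1).trans ?_)
    rw [ENNReal.tsum_mul_left]
    exact mul_le_of_le_one_right' hsum
  have key := sq_le_volume_of_many_plates hρ.le (η := c / ((k : ℝ) + 1) ^ 2)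
    (ζ := c / ((k : ℝ) + 1) ^ 2 * V) (by positivity) k b w (hPm k) hFm hPF
    (Θ := Θ k) (fun a ha => ha.1) hk (fun a ha => ha.2)
  have key := key.trans (mul_le_mul_left hFvol _)
  rw [← ENNReal.ofReal_mul (by positivity), ← ENNReal.ofReal_pow (by positivity),
    ENNReal.ofReal_le_ofReal_iff (by positivity), ← hC] at key
  have hfin := hm k hmk
  have hk0 : (0 : ℝ) < (k : ℝ) + 1 := by positivity
  have h4 : (2 * (c / ((k : ℝ) + 1) ^ 2) * (c / ((k : ℝ) + 1) ^ 2 * V)) ^ 2 =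
      4 * c ^ 4 * V ^ 2 / ((k : ℝ) + 1) ^ 8 := by
    field_simp
    ring
  rw [h4, div_le_iff₀ (by positivity)] at key
  nlinarith

/-! ### Projecting the meridians along the axis -/

theorem isMeridian_of_normal {q : ℕ} {c N S ν : EuclideanSpace ℝ (Fin (q + 3))} (r : ℝ)
    (hNS : midpoint ℝ N S = c) (hν : ν ≠ 0) (hνN : ⟪ν, N - c⟫_ℝ = 0) :
    IsMeridian c r N S {x | ⟪ν, x - c⟫_ℝ = 0 ∧ x ∈ sphere c r} := by
  have : Fact (Module.finrank ℝ (EuclideanSpace ℝ (Fin (q + 3))) = (q + 2) + 1) := ⟨by simp⟩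
  have hmem : ∀ x, x ∈ AffineSubspace.mk' c (ℝ ∙ ν)ᗮ ↔ ⟪ν, x - c⟫_ℝ = 0 := fun x => by
    rw [AffineSubspace.mem_mk', Submodule.mem_orthogonal_singleton_iff_inner_right, vsub_eq_sub]
  refine ⟨AffineSubspace.mk' c (ℝ ∙ ν)ᗮ, ?_, (hmem N).2 hνN, (hmem S).2 ?_, ?_⟩
  · rw [AffineSubspace.direction_mk', Submodule.finrank_orthogonal_span_singleton (n := q + 2) hν]
  · have : S - c = -(N - c) := by
      rw [← hNS, ← vsub_eq_sub, ← vsub_eq_sub, right_vsub_midpoint, left_vsub_midpoint,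
        ← smul_neg, neg_vsub_eq_vsub_rev]
    rw [this, inner_neg_right, hνN, neg_zero]
  · ext x
    exact and_congr_left' (hmem x).symm

theorem le_dimH_of_containsMeridianTranslates {q : ℕ} {r : ℝ} (hr : 0 < r)
    {c N S : EuclideanSpace ℝ (Fin (q + 3))} (hN : N ∈ sphere c r) (hNS : midpoint ℝ N S = c)
    {K : Set (EuclideanSpace ℝ (Fin (q + 3)))} (hK : ContainsMeridianTranslates c r N S K) :
    ((q + 2 : ℕ) : ℝ≥0∞) ≤ dimH K := by
  rw [mem_sphere, dist_eq_norm] at hN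
  -- Only `B 0`, the axis direction, is prescribed.
  obtain ⟨B, hB⟩ := Orthonormal.exists_orthonormalBasis_extension_of_card_eq (𝕜 := ℝ)
    (ι := Fin (q + 3)) (E := EuclideanSpace ℝ (Fin (q + 3))) (by simp)
    (v := fun _ => r⁻¹ • (N - c)) (s := {0}) (by
      constructor
      · intro i
        simp [Set.domRestrict, norm_smul, hN, abs_of_pos hr, hr.ne']
      · intro i j hij
        exact absurd (Subsingleton.elim i j) hij)
  have hB0 : N - c = r • B 0 := by
    rw [hB 0 rfl, smul_smul, mul_inv_cancel₀ hr.ne', one_smul]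
  have hBB : ∀ i j, ⟪B i, B j⟫_ℝ = if i = j then 1 else 0 :=
    orthonormal_iff_ite.1 B.orthonormal
  have hrepr : ∀ i g, ⟪B i, B.repr.symm g⟫_ℝ = g i := fun i g => by
    rw [← B.repr_apply_apply, LinearIsometryEquiv.apply_symm_apply]
  set φ : EuclideanSpace ℝ (Fin (q + 3)) →L[ℝ] (Fin (q + 1) → ℝ) × ℝ :=
    (ContinuousLinearMap.pi fun j => innerSL ℝ (B j.succ.succ)).prod (innerSL ℝ (B 1)) with hφ
  have hφx : ∀ x, φ x = (fun j => ⟪B j.succ.succ, x⟫_ℝ, ⟪B 1, x⟫_ℝ) := fun x => rfl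
  have hne1 : ((0 : Fin (q + 1)).succ.succ : Fin (q + 3)) ≠ 1 := fun h =>
    Fin.succ_ne_zero _ (Fin.succ_injective _ h)
  refine le_trans ?_ (φ.lipschitz.dimH_image_le K)
  -- This side keeps the `q + 2` squared coordinates of a cube point off the axis within `r ^ 2`.
  refine le_dimH_of_forall_slope (ρ := r / (q + 3)) (by positivity) fun a ha => ?_
  set ν := B 1 - a • B (Fin.succ (Fin.succ 0)) with hν
  have hν1 : ⟪ν, B 1⟫_ℝ = 1 := by
    rw [hν, inner_sub_left, real_inner_smul_left, hBB, hBB, if_pos rfl, if_neg hne1]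
    ring
  have hν0 : ν ≠ 0 := by
    rintro h
    rw [h, inner_zero_left] at hν1
    exact zero_ne_one hν1
  have hνN : ⟪ν, N - c⟫_ℝ = 0 := by
    rw [hB0, real_inner_smul_right, hν, inner_sub_left, real_inner_smul_left, hBB, hBB,
      if_neg (one_ne_zero : (1 : Fin (q + 3)) ≠ 0), if_neg (Fin.succ_ne_zero _)]
    ring
  obtain ⟨v, hv⟩ := hK _ (isMeridian_of_normal r hNS hν0 hνN)
  set w : Fin (q + 1) → ℝ := fun j => ⟪B j.succ.succ, v + c⟫_ℝ with hw
  refine ⟨⟪B 1, v + c⟫_ℝ - a * w 0, w, fun y hy => ?_⟩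
  have hz : ∀ j, (y j - w j) ^ 2 ≤ (r / (q + 3)) ^ 2 := fun j => by
    rw [mem_closedBall] at hy
    have h1 := (dist_le_pi_dist y w j).trans hy
    rw [Real.dist_eq] at h1
    exact sq_le_sq.2 (h1.trans (le_abs_self _))
  have hsum : (a * (y 0 - w 0)) ^ 2 + ∑ j, (y j - w j) ^ 2 ≤ r ^ 2 := by
    have h1 : ∑ j, (y j - w j) ^ 2 ≤ (q + 1) * (r / (q + 3)) ^ 2 := by
      refine (Finset.sum_le_sum fun j _ => hz j).trans_eq ?_
      simp
    have h2 : (a * (y 0 - w 0)) ^ 2 ≤ (r / (q + 3)) ^ 2 := by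
      rw [mul_pow]
      have : a ^ 2 ≤ 1 := pow_le_one₀ ha.1 ha.2.le
      nlinarith [hz 0, sq_nonneg (y 0 - w 0)]
    have h3 : ((q : ℝ) + 2) * (r / (q + 3)) ^ 2 ≤ r ^ 2 := by
      rw [div_pow, mul_div_assoc', div_le_iff₀ (by positivity), mul_comm]
      refine mul_le_mul_of_nonneg_left ?_ (by positivity)
      nlinarith [Nat.cast_nonneg (α := ℝ) q]
    linarith
  -- The axis coordinate that lifts the projected point back to the sphere.
  set t : ℝ := √(r ^ 2 - ((a * (y 0 - w 0)) ^ 2 + ∑ j, (y j - w j) ^ 2)) with ht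
  set g : EuclideanSpace ℝ (Fin (q + 3)) := WithLp.toLp 2
    (Fin.cons t (Fin.cons (a * (y 0 - w 0)) fun j => y j - w j : Fin (q + 2) → ℝ)) with hg
  have hg1 : g 1 = a * (y 0 - w 0) := rfl
  have hgs : ∀ j : Fin (q + 1), g j.succ.succ = y j - w j := fun j => rfl
  have hgn : ‖g‖ = r := by
    have h1 : ‖g‖ ^ 2 = r ^ 2 := by
      rw [EuclideanSpace.real_norm_sq_eq, Fin.sum_univ_succ, Fin.sum_univ_succ]
      have h2 : g 0 = t := rfl
      have h3 : g (Fin.succ 0) = a * (y 0 - w 0) := rfl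
      simp only [h2, h3, hgs]
      rw [ht, Real.sq_sqrt (by linarith)]
      ring
    exact (pow_left_inj₀ (norm_nonneg _) hr.le two_ne_zero).1 h1
  have hx : c + B.repr.symm g ∈ {x | ⟪ν, x - c⟫_ℝ = 0 ∧ x ∈ sphere c r} := by
    refine ⟨?_, ?_⟩
    · rw [add_sub_cancel_left, hν, inner_sub_left, real_inner_smul_left, hrepr, hrepr, hg1, hgs,
        sub_self]
    · rw [mem_sphere, dist_eq_norm, add_sub_cancel_left, LinearIsometryEquiv.norm_map, hgn]
  refine ⟨v + (c + B.repr.symm g), hv ⟨_, hx, rfl⟩, ?_⟩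
  rw [hφx, ← add_assoc]
  refine Prod.ext (funext fun j => ?_) ?_
  · simp only
    rw [inner_add_right, hrepr, hgs]
    simp only [hw]
    ring
  · simp only
    rw [inner_add_right, hrepr, hg1]
    ring

/-! ### Sharpness: the sphere itself -/

/-- Apart from the point `N`, the sphere is covered by a `C¹` image of the `m`-dimensional space `(ℝ
∙ u)ᗮ`, under inverse stereographic projection. -/
theorem dimH_sphere_le {E : Type*} [NormedAddCommGroup E] [InnerProductSpace ℝ E] {m : ℕ}
    [Fact (Module.finrank ℝ E = m + 1)] {r : ℝ} (hr : 0 < r) {c N : E} (hN : N ∈ sphere c r) :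
    dimH (sphere c r) ≤ m := by
  have : FiniteDimensional ℝ E := .of_fact_finrank_eq_succ m
  rw [mem_sphere, dist_eq_norm] at hN
  set u : E := r⁻¹ • (N - c) with hu
  have hu1 : ‖u‖ = 1 := by
    rw [hu, norm_smul, hN, norm_inv, Real.norm_of_nonneg hr.le, inv_mul_cancel₀ hr.ne']
  set f : (ℝ ∙ u)ᗮ → E := fun w => c + r • stereoInvFunAux u (w : E) with hf
  have hfc : ContDiff ℝ 1 f :=
    contDiff_const.add ((contDiff_stereoInvFunAux.comp (ℝ ∙ u)ᗮ.subtypeL.contDiff).const_smul r)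
  have hsub : sphere c r ⊆ {N} ∪ range f := by
    intro x hx
    rw [mem_sphere, dist_eq_norm] at hx
    by_cases hxN : x = N
    · exact Or.inl hxN
    right
    have hy : r⁻¹ • (x - c) ∈ sphere (0 : E) 1 := by
      rw [mem_sphere_zero_iff_norm, norm_smul, hx, norm_inv, Real.norm_of_nonneg hr.le,
        inv_mul_cancel₀ hr.ne']
    have hyu : r⁻¹ • (x - c) ≠ u := fun h =>
      hxN (sub_left_injective (smul_right_injective E (inv_ne_zero hr.ne') h))
    have h := congrArg Subtype.val (stereo_left_inv hu1 (x := ⟨_, hy⟩) hyu)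
    refine ⟨stereoToFun u (r⁻¹ • (x - c)), ?_⟩
    have h' : stereoInvFunAux u (stereoToFun u (r⁻¹ • (x - c)) : E) = r⁻¹ • (x - c) := h
    simp only [hf]
    rw [h', smul_smul, mul_inv_cancel₀ hr.ne', one_smul, add_sub_cancel]
  refine (dimH_mono hsub).trans ?_
  rw [dimH_union, dimH_singleton]
  refine max_le zero_le (hfc.dimH_range_le.trans_eq ?_)
  rw [Submodule.finrank_orthogonal_span_singleton (n := m)
    (norm_ne_zero_iff.1 (by rw [hu1]; exact one_ne_zero))]

theorem containsMeridianTranslates_sphere {n : ℕ} (c : EuclideanSpace ℝ (Fin n)) (r : ℝ)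
    (N S : EuclideanSpace ℝ (Fin n)) : ContainsMeridianTranslates c r N S (sphere c r) := by
  rintro C ⟨H, -, -, -, rfl⟩
  refine ⟨0, ?_⟩
  rintro _ ⟨x, hx, rfl⟩
  simpa using hx.2

theorem theorem2 (n : ℕ) (hn : 3 ≤ n) (r : ℝ) (hr : 0 < r)
    (c N S : EuclideanSpace ℝ (Fin n)) (hN : N ∈ sphere c r) (hNS : midpoint ℝ N S = c) :
    (∀ K : Set (EuclideanSpace ℝ (Fin n)), IsBounded K →
        ContainsMeridianTranslates c r N S K → ((n - 1 : ℕ) : ℝ≥0∞) ≤ dimH K) ∧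
      (IsBounded (sphere c r) ∧ ContainsMeridianTranslates c r N S (sphere c r) ∧
        dimH (sphere c r) = ((n - 1 : ℕ) : ℝ≥0∞)) := by
  obtain ⟨q, rfl⟩ := Nat.exists_eq_add_of_le' hn
  have : Fact (Module.finrank ℝ (EuclideanSpace ℝ (Fin (q + 3))) = (q + 2) + 1) := ⟨by simp⟩
  have hsphere := containsMeridianTranslates_sphere c r N S
  exact ⟨fun K _ hK => le_dimH_of_containsMeridianTranslates hr hN hNS hK, isBounded_sphere,
    hsphere, le_antisymm (dimH_sphere_le (m := q + 2) hr hN)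
      (le_dimH_of_containsMeridianTranslates hr hN hNS hsphere)⟩
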